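/- Let $\mathfrak g$ be an affine Kac–Moody algebra with index set $I$, Cartan matrix $(a_{ij})$, coroots $h_i$, canonical central element $c=\sum_i a_i^\vee h_i$, and $0\in I$ the affine vertex (so $a_0^\vee=1$, as in Kac's tables). Let $P_{\rm cl}=\mathrm{Hom}(\bigoplus_i\mathbb Z h_i,\mathbb Z)$, with fundamental weights $\Lambda_i$ and (classes of) simple roots $\alpha_i$, let $P_{\rm cl}^0=\{\lambda\in P_{\rm cl}:\langle c,\lambda\rangle=0\}$, and for $l\ge 1$ let $(P_{\rm cl}^+)_l=\{\lambda\in P_{\rm cl}:\langle h_i,\lambda\rangle\ge 0\ \forall i,\ \langle c,\lambda\rangle=l\}$ be the set of dominant integral weights of level $l$. Crystals (in Kashiwara's sense) have weights in $P_{\rm cl}$, and we write $\varepsilon(b)=\sum_i\varepsilon_i(b)\Lambda_i$, $\varphi(b)=\sum_i\varphi_i(b)\Lambda_i$. A morphism of crystals is a map $\psi:B_1\sqcup\{0\}\to B_2\sqcup\{0\}$ with $\psi(0)=0$ which preserves $\mathrm{wt},\varepsilon_i,\varphi_i$ whenever $\psi(b)\ne0$, and satisfies $\psi(\tilde e_ib)=\tilde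 e_i\psi(b)$ (resp. $\psi(\tilde f_ib)=\tilde f_i\psi(b)$) whenever $\tilde e_ib$ (resp. $\tilde f_ib$), $\psi(b)$ and the left-hand side are nonzero; it is an embedding if it is injective on $B_1\sqcup\{0\}$. Tensor products follow the rule $\tilde e_i(b_1\otimes b_2)=\tilde e_ib_1\otimes b_2$ if $\varphi_i(b_1)\ge\varepsilon_i(b_2)$ and $b_1\otimes\tilde e_ib_2$ otherwise, and $T_\lambda=\{t_\lambda\}$ is the one-element crystal with $\mathrm{wt}(t_\lambda)=\lambda$, $\varepsilon_i(t_\lambda)=\varphi_i(t_\lambda)=-\infty$. A crystal $B$ is perfect of level $l\ge1$ if: $B\otimes B$ is connected; there is $\lambda_0\in P_{\rm cl}$ with $\mathrm{wt}(B)\subset\lambda_0+\sum_{i\ne0}\mathbb Z_{\le0}\alpha_i$ and exactly one element of weight $\lambda_0$; $B$ is isomorphic to $B_{ps}/\{\pm1\}$ for a crystal pseudo-base $(L,B_{ps})$ of a finite-dimensional integrable $U_q'(\mathfrak g)$-module; $\langle c,\varepsilon(b)\rangle\ge l$ for all $b\in B$; and $\varepsilon$ and $\varphi$ both map $B^{\min}=\{b\in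 B:\langle c,\varepsilon(b)\rangle=l\}$ bijectively onto $(P_{\rm cl}^+)_l$. A family $\{B_l\}_{l\ge1}$ of perfect crystals $B_l$ of level $l$ is coherent if it has a limit: a crystal $B_\infty$ with an element $b_\infty$ such that $\mathrm{wt}(b_\infty)=0$ and $\varepsilon_i(b_\infty)=\varphi_i(b_\infty)=0$ for all $i$, together with embeddings $f_{(l,b)}:T_{\varepsilon(b)}\otimes B_l\otimes T_{-\varphi(b)}\to B_\infty$ sending $t_{\varepsilon(b)}\otimes b\otimes t_{-\varphi(b)}$ to $b_\infty$, for all $l\ge1$ and $b\in B_l^{\min}$, whose images cover $B_\infty$. Let $\{B_l\}_{l\ge1}$ be a coherent family of perfect crystals, and put $B_\infty^{\min}=\{b\in B_\infty:\langle c,\varepsilon(b)\rangle=0\}$. Suppose that the automorphism of $P_{\rm cl}^0$ given by $\varphi(b)\mapsto\varepsilon(b)$ ($b\in B_\infty^{\min}$) extends to a linear automorphism $\sigma$ of $P_{\rm cl}$ such that $\sigma\varphi(b)=\varepsilon(b)$ for all $l\ge1$ and all $b\in B_l^{\min}$. Let $1\le k<l$ be integers, let $\lambda$ be a dominant integral weight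 of level $k$, and put $\lambda'=\sigma^{-1}\lambda$. Then there exists a unique embedding of crystals $$\psi:B_{l-k}\to T_\lambda\otimes B_l\otimes T_{-\lambda'},$$ and moreover $\psi(B_{l-k}^{\min})\subset T_\lambda\otimes B_l^{\min}\otimes T_{-\lambda'}$. -/

import Mathlib

open scoped BigOperators

noncomputable section

namespace AffineCrystals

universe u w

/-! ### Affine Cartan data and classical weights -/

/-- A generalized Cartan matrix of affine type: an indecomposable generalized Cartan matrix `A`
with a strictly positive null vector.  `a` are the coefficients of the null root
`δ = ∑ a i • α i`, `c` those of the canonical central element `c = ∑ c i • h i`; each is the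
primitive positive integral vector in the kernel of `A`, resp. of its transpose.
`zero` is the affine vertex `0` of the index set; as in Kac's tables, the coefficient of
`h 0` in the canonical central element is `1`. -/
structure AffineDatum (I : Type w) [Fintype I] where
  A : Matrix I I ℤ
  diag : ∀ i, A i i = 2
  offDiag : ∀ i j, i ≠ j → A i j ≤ 0
  zero_symm : ∀ i j, A i j = 0 → A j i = 0
  indecomposable : ∀ S : Set I, S.Nonempty → Sᶜ.Nonempty → ∃ i ∈ S, ∃ j ∈ Sᶜ, A i j ≠ 0
  a : I → ℕ
  a_pos : ∀ i, 0 < a i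
  a_null : ∀ i, ∑ j, A i j * (a j : ℤ) = 0
  a_primitive : Finset.univ.gcd a = 1
  c : I → ℕ
  c_pos : ∀ i, 0 < c i
  c_null : ∀ j, ∑ i, (c i : ℤ) * A i j = 0
  c_primitive : Finset.univ.gcd c = 1
  zero : I
  c_zero : c zero = 1

/-- The classical weight lattice `P_cl = Hom(Q^∨, ℤ)`; `μ i` is the pairing `⟨h i, μ⟩`. -/
abbrev Pcl (I : Type w) : Type w := I → ℤ

variable {I : Type w} [Fintype I]

/-- The class in `P_cl` of the simple root `α j`. -/
def AffineDatum.root (D : AffineDatum I) (j : I) : Pcl I := fun i => D.A i j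

/-- `⟨c, μ⟩`. -/
def AffineDatum.level (D : AffineDatum I) (μ : Pcl I) : ℤ := ∑ i, (D.c i : ℤ) * μ i

/-- `(P_cl^+)_l`, the dominant integral weights of level `l`. -/
def AffineDatum.dominant (D : AffineDatum I) (l : ℕ) : Set (Pcl I) :=
  {μ | (∀ i, 0 ≤ μ i) ∧ D.level μ = l}

/-! ### Crystals -/

/-- A crystal with weights in `P_cl`.  `none : Option _` plays the role of `0` and
`⊥ : WithBot ℤ` that of `-∞`.  (The companion rules for the weight and for `φ` under `f i`,
and for `φ` under `e i`, follow: see `Crystal.wt_f`, `Crystal.phi_e`, `Crystal.phi_f`.) -/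
structure Crystal (D : AffineDatum I) where
  carrier : Type u
  wt : carrier → Pcl I
  ε : I → carrier → WithBot ℤ
  φ : I → carrier → WithBot ℤ
  e : I → carrier → Option carrier
  f : I → carrier → Option carrier
  phi_eq : ∀ i b, φ i b = ε i b + ((wt b i : ℤ) : WithBot ℤ)
  wt_e : ∀ i b b', e i b = some b' → wt b' = wt b + D.root i
  eps_e : ∀ i b b', e i b = some b' → ε i b = ε i b' + 1
  f_iff_e : ∀ i b b', f i b = some b' ↔ e i b' = some b
  of_eps_bot : ∀ i b, ε i b = ⊥ → e i b = none ∧ f i b = none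

namespace Crystal

variable {D : AffineDatum I}

theorem wt_f (C : Crystal.{u} D) (i : I) (b b' : C.carrier) (h : C.f i b = some b') :
    C.wt b' = C.wt b - D.root i := by
  rw [C.wt_e i b' b ((C.f_iff_e i b b').1 h)]; simp

theorem eps_f (C : Crystal.{u} D) (i : I) (b b' : C.carrier) (h : C.f i b = some b') :
    C.ε i b' = C.ε i b + 1 := C.eps_e i b' b ((C.f_iff_e i b b').1 h)

theorem phi_e (C : Crystal.{u} D) (i : I) (b b' : C.carrier) (h : C.e i b = some b') :
    C.φ i b' = C.φ i b + 1 := by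
  rw [C.phi_eq, C.phi_eq, C.eps_e i b b' h, C.wt_e i b b' h]
  cases hx : C.ε i b' with
  | bot => rfl
  | coe x =>
    have h2 : D.root i i = 2 := D.diag i
    simp only [Pi.add_apply, h2]
    norm_cast
    ring

theorem phi_f (C : Crystal.{u} D) (i : I) (b b' : C.carrier) (h : C.f i b = some b') :
    C.φ i b = C.φ i b' + 1 := C.phi_e i b' b ((C.f_iff_e i b b').1 h)

/-- `ε(b) = ∑ ε_i(b) Λ_i ∈ P_cl`, meaningful when all `ε_i(b)` are integers (which holds for
all the elements of perfect crystals and of their limits). -/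
def eps (C : Crystal.{u} D) (b : C.carrier) : Pcl I := fun i => (C.ε i b).unbotD 0

/-- `φ(b) = ∑ φ_i(b) Λ_i ∈ P_cl`, with the same proviso. -/
def phi (C : Crystal.{u} D) (b : C.carrier) : Pcl I := fun i => (C.φ i b).unbotD 0

/-- `{b | ⟨c, ε(b)⟩ = l}`: this is `B_l^min` for a perfect crystal `B_l` of level `l`, and
`B_∞^min` for `l = 0` and a limit `B_∞`. -/
def minSet (C : Crystal.{u} D) (l : ℕ) : Set C.carrier := {b | D.level (C.eps b) = l}

/-- The one-element crystal `T_μ = {t_μ}`. -/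
def T (D : AffineDatum I) (μ : Pcl I) : Crystal.{u} D where
  carrier := PUnit
  wt _ := μ
  ε _ _ := ⊥
  φ _ _ := ⊥
  e _ _ := none
  f _ _ := none
  phi_eq _ _ := rfl
  wt_e _ _ _ h := by simp at h
  eps_e _ _ _ h := by simp at h
  f_iff_e _ _ _ := by simp
  of_eps_bot _ _ _ := ⟨rfl, rfl⟩

/-- The operator `ẽ_i` on a tensor product. -/
def tensorE (C₁ C₂ : Crystal.{u} D) (i : I) (b : C₁.carrier × C₂.carrier) :
    Option (C₁.carrier × C₂.carrier) :=
  if C₂.ε i b.2 ≤ C₁.φ i b.1 then (C₁.e i b.1).map (fun x => (x, b.2))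
  else (C₂.e i b.2).map (fun y => (b.1, y))

/-- The operator `f̃_i` on a tensor product. -/
def tensorF (C₁ C₂ : Crystal.{u} D) (i : I) (b : C₁.carrier × C₂.carrier) :
    Option (C₁.carrier × C₂.carrier) :=
  if C₂.ε i b.2 < C₁.φ i b.1 then (C₁.f i b.1).map (fun x => (x, b.2))
  else (C₂.f i b.2).map (fun y => (b.1, y))

/-- The tensor product `C₁ ⊗ C₂` of crystals. -/
def tensor (C₁ C₂ : Crystal.{u} D) : Crystal.{u} D where
  carrier := C₁.carrier × C₂.carrier
  wt b := C₁.wt b.1 + C₂.wt b.2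
  ε i b := max (C₁.ε i b.1) (C₂.ε i b.2 + ((-(C₁.wt b.1 i) : ℤ) : WithBot ℤ))
  φ i b := max (C₂.φ i b.2) (C₁.φ i b.1 + ((C₂.wt b.2 i : ℤ) : WithBot ℤ))
  e := tensorE C₁ C₂
  f := tensorF C₁ C₂
  phi_eq i b := by
    have h1 := C₁.phi_eq i b.1
    have h2 := C₂.phi_eq i b.2
    simp only [Pi.add_apply]
    rw [h1, h2]
    generalize C₁.ε i b.1 = x
    generalize C₂.ε i b.2 = y
    cases x <;> cases y <;>
      simp only [WithBot.bot_add, bot_sup_eq, sup_bot_eq, ← WithBot.coe_add, ← WithBot.coe_sup,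
        WithBot.coe_inj] <;> grind
  wt_e i b b' h := by
    unfold tensorE at h
    split_ifs at h
    · obtain ⟨x, hx, rfl⟩ := Option.map_eq_some_iff.1 h
      simp only [C₁.wt_e i _ _ hx]; abel
    · obtain ⟨x, hx, rfl⟩ := Option.map_eq_some_iff.1 h
      simp only [C₂.wt_e i _ _ hx]; abel
  eps_e i b b' h := by
    unfold tensorE at h
    have h2 : D.root i i = 2 := D.diag i
    split_ifs at h with hc
    · obtain ⟨x, hx, rfl⟩ := Option.map_eq_some_iff.1 h
      have hw := congrFun (C₁.wt_e i _ _ hx) i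
      have he := C₁.eps_e i _ _ hx
      have hp := C₁.phi_eq i b.1
      simp only [Pi.add_apply, h2] at hw
      rw [hp, he] at hc
      rw [hw, he]
      have hb : C₁.ε i x ≠ ⊥ := by
        intro h0
        have h1 := (C₁.of_eps_bot i b.1 (by rw [he, h0]; rfl)).1
        rw [h1] at hx; simp at hx
      revert hc hb
      generalize C₁.ε i x = x
      generalize C₂.ε i b.2 = y
      have h1 : (1 : WithBot ℤ) = ((1 : ℤ) : WithBot ℤ) := rfl
      rw [h1]
      cases x <;> cases y <;>
        simp only [WithBot.bot_add, sup_bot_eq, ← WithBot.coe_add,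
          ← WithBot.coe_sup, WithBot.coe_inj, WithBot.coe_le_coe] <;> grind
    · obtain ⟨y, hy, rfl⟩ := Option.map_eq_some_iff.1 h
      have he := C₂.eps_e i _ _ hy
      have hp := C₁.phi_eq i b.1
      rw [hp, he] at hc
      rw [he]
      have hb : C₂.ε i y ≠ ⊥ := by
        intro h0
        have h1 := (C₂.of_eps_bot i b.2 (by rw [he, h0]; rfl)).1
        rw [h1] at hy; simp at hy
      revert hc hb
      generalize C₁.ε i b.1 = x
      generalize C₂.ε i y = y
      have h1 : (1 : WithBot ℤ) = ((1 : ℤ) : WithBot ℤ) := rfl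
      rw [h1]
      cases x <;> cases y <;>
        simp only [WithBot.bot_add, bot_sup_eq, ← WithBot.coe_add,
          ← WithBot.coe_sup, WithBot.coe_inj, WithBot.coe_le_coe] <;> grind
  f_iff_e i b b' := by
    have one : (1 : WithBot ℤ) = ((1 : ℤ) : WithBot ℤ) := rfl
    have key : ∀ x y : WithBot ℤ, x ≠ ⊥ → (y < x + 1 ↔ y ≤ x) := by
      intro x y hx
      rw [one]
      cases x <;> cases y <;>
        try simp only [← WithBot.coe_add, WithBot.coe_le_coe, WithBot.coe_lt_coe,
          WithBot.bot_lt_coe, bot_le]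
      all_goals grind
    have key2 : ∀ x y : WithBot ℤ, y ≠ ⊥ → (y < x ↔ y + 1 ≤ x) := by
      intro x y hx
      rw [one]
      cases x <;> cases y <;>
        try simp only [← WithBot.coe_add, WithBot.coe_le_coe, WithBot.coe_lt_coe,
          WithBot.not_coe_le_bot, not_lt_bot]
      all_goals grind
    obtain ⟨b₁, b₂⟩ := b
    obtain ⟨b₁', b₂'⟩ := b'
    have A : ∀ x x', C₁.f i x = some x' → (C₂.ε i b₂ < C₁.φ i x ↔ C₂.ε i b₂ ≤ C₁.φ i x') := by
      intro x x' hx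
      rw [C₁.phi_f i x x' hx]
      refine key _ _ fun h0 => ?_
      have h1 : C₁.ε i x' = ⊥ := by
        have := C₁.phi_eq i x'
        rw [h0] at this
        cases h : C₁.ε i x' with
        | bot => rfl
        | coe z => rw [h, ← WithBot.coe_add] at this; exact absurd this.symm (WithBot.coe_ne_bot)
      have h2 := (C₁.of_eps_bot i x' h1).1
      rw [(C₁.f_iff_e i x x').1 hx] at h2
      simp at h2
    have B : ∀ y y', C₂.f i y = some y' → (C₂.ε i y < C₁.φ i b₁ ↔ C₂.ε i y' ≤ C₁.φ i b₁) := by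
      intro y y' hy
      rw [C₂.eps_f i y y' hy]
      refine key2 _ _ fun h0 => ?_
      have h2 := (C₂.of_eps_bot i y h0).2
      rw [hy] at h2
      simp at h2
    have hf := C₁.f_iff_e i
    have hg := C₂.f_iff_e i
    constructor
    · intro h
      unfold tensorF at h
      unfold tensorE
      split_ifs at h with hc
      · obtain ⟨x, hx, hx'⟩ := Option.map_eq_some_iff.1 h
        simp only [Prod.mk.injEq] at hx'
        obtain ⟨rfl, rfl⟩ := hx'
        rw [if_pos ((A _ _ hx).1 hc), (hf _ _).1 hx]; rfl
      · obtain ⟨x, hx, hx'⟩ := Option.map_eq_some_iff.1 h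
        simp only [Prod.mk.injEq] at hx'
        obtain ⟨rfl, rfl⟩ := hx'
        rw [if_neg (fun h' => hc ((B _ _ hx).2 h')), (hg _ _).1 hx]; rfl
    · intro h
      unfold tensorE at h
      unfold tensorF
      split_ifs at h with hc
      · obtain ⟨x, hx, hx'⟩ := Option.map_eq_some_iff.1 h
        simp only [Prod.mk.injEq] at hx'
        obtain ⟨rfl, rfl⟩ := hx'
        have hx := (hf _ _).2 hx
        rw [if_pos ((A _ _ hx).2 hc), hx]; rfl
      · obtain ⟨x, hx, hx'⟩ := Option.map_eq_some_iff.1 h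
        simp only [Prod.mk.injEq] at hx'
        obtain ⟨rfl, rfl⟩ := hx'
        have hx := (hg _ _).2 hx
        rw [if_neg (fun h' => hc ((B _ _ hx).1 h')), hx]; rfl
  of_eps_bot i b h := by
    obtain ⟨h1, h2⟩ := max_eq_bot.1 h
    have h2' : C₂.ε i b.2 = ⊥ := by
      cases hh : C₂.ε i b.2 with
      | bot => rfl
      | coe z => rw [hh, ← WithBot.coe_add] at h2; exact absurd h2 (WithBot.coe_ne_bot)
    have a1 := C₁.of_eps_bot i b.1 h1
    have a2 := C₂.of_eps_bot i b.2 h2'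
    unfold tensorE tensorF
    rw [a1.1, a1.2, a2.1, a2.2]
    simp

/-- Morphisms of crystals, as maps `B₁ ⊔ {0} → B₂ ⊔ {0}`. -/
structure IsMorphism (C₁ C₂ : Crystal.{u} D) (ψ : Option C₁.carrier → Option C₂.carrier) :
    Prop where
  map_zero : ψ none = none
  map_e : ∀ i b b' x x', C₁.e i b = some b' → ψ (some b) = some x → ψ (some b') = some x' →
    C₂.e i x = some x'
  map_f : ∀ i b b' x x', C₁.f i b = some b' → ψ (some b) = some x → ψ (some b') = some x' →
    C₂.f i x = some x'
  map_wt : ∀ b x, ψ (some b) = some x → C₂.wt x = C₁.wt b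
  map_eps : ∀ i b x, ψ (some b) = some x → C₂.ε i x = C₁.ε i b
  map_phi : ∀ i b x, ψ (some b) = some x → C₂.φ i x = C₁.φ i b

/-- An embedding is a morphism that is injective on `B₁ ⊔ {0}`. -/
def IsEmbedding (C₁ C₂ : Crystal.{u} D) (ψ : Option C₁.carrier → Option C₂.carrier) : Prop :=
  IsMorphism C₁ C₂ ψ ∧ Function.Injective ψ

/-- Connectedness of the crystal graph, whose (coloured) arrows are `b → f̃_i b`. -/
def Connected (C : Crystal.{u} D) : Prop :=
  Nonempty C.carrier ∧
    ∀ b b', Relation.EqvGen (fun x y : C.carrier => ∃ i, C.f i x = some y) b b'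

/-- `ε_i(b) = max {n | ẽ_i^n b ≠ 0}` and `φ_i(b) = max {n | f̃_i^n b ≠ 0}`. -/
def StringLengths (C : Crystal.{u} D) : Prop :=
  ∀ i b,
    (∃ n : ℕ, C.ε i b = ((n : ℤ) : WithBot ℤ) ∧
      IsGreatest {m : ℕ | (fun x => x.bind (C.e i))^[m] (some b) ≠ none} n) ∧
    (∃ n : ℕ, C.φ i b = ((n : ℤ) : WithBot ℤ) ∧
      IsGreatest {m : ℕ | (fun x => x.bind (C.f i))^[m] (some b) ≠ none} n)

/-- `T_μ ⊗ C ⊗ T_ν`. -/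
def shift (C : Crystal.{u} D) (μ ν : Pcl I) : Crystal.{u} D :=
  ((T D μ).tensor C).tensor (T D ν)

/-- The element `t_μ ⊗ b ⊗ t_ν` of `T_μ ⊗ C ⊗ T_ν`. -/
def shiftElt (C : Crystal.{u} D) (μ ν : Pcl I) (b : C.carrier) : (C.shift μ ν).carrier :=
  ((PUnit.unit, b), PUnit.unit)

end Crystal

/-! ### The quantized affine algebra `U'_q(g)` and its modules -/

/-- The base field `ℂ(q^{1/γ})`; its variable is `q_s = q^{1/γ}`. -/
abbrev K : Type := RatFunc ℂ

/-- `q_s = q^{1/γ}`. -/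
def qs : K := RatFunc.X

/-- The smallest positive integer `γ` such that all `γ (α i, α i) / 2` are integers.  For the
invariant form normalized by `(δ, μ) = ⟨c, μ⟩` one has `(α i, α i) / 2 = c i / a i`. -/
def AffineDatum.γ (D : AffineDatum I) : ℕ := sInf {g | 0 < g ∧ ∀ i, D.a i ∣ g * D.c i}

/-- The integer `γ (α i, α i) / 2` (the division is exact). -/
def AffineDatum.m (D : AffineDatum I) (i : I) : ℕ := D.γ * D.c i / D.a i

/-- `q_i = q^{(α i, α i) / 2} = q_s^{γ (α i, α i) / 2}`. -/
def AffineDatum.qi (D : AffineDatum I) (i : I) : K := qs ^ D.m i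

/-- The `q`-integer `[n]_i`. -/
def AffineDatum.qint (D : AffineDatum I) (i : I) (n : ℕ) : K :=
  (D.qi i ^ n - (D.qi i)⁻¹ ^ n) / (D.qi i - (D.qi i)⁻¹)

/-- The `q`-factorial `[n]_i!`. -/
def AffineDatum.qfact (D : AffineDatum I) (i : I) (n : ℕ) : K :=
  ∏ k ∈ Finset.range n, D.qint i (k + 1)

/-- The divided power `x^{(n)} = x^n / [n]_i!`. -/
def AffineDatum.dpow (D : AffineDatum I) {R : Type*} [Ring R] [Algebra K R]
    (i : I) (x : R) (n : ℕ) : R := (D.qfact i n)⁻¹ • x ^ n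

/-- Generators of `U'_q(g)`; `qh n` is `q(h)` for `h = γ⁻¹ ∑ n i • h i ∈ γ⁻¹ Q^∨`. -/
inductive UGen (I : Type w) : Type w
  | e (i : I)
  | f (i : I)
  | qh (n : I → ℤ)

/-- The generators in the free algebra. -/
def gen (x : UGen I) : FreeAlgebra K (UGen I) := FreeAlgebra.ι K x

open Classical in
/-- `t_i = q((α i, α i) / 2 • h i)` is `tq D i 1`, and its inverse is `tq D i (-1)`. -/
def tq (D : AffineDatum I) (i : I) (s : ℤ) : FreeAlgebra K (UGen I) :=
  gen (.qh (Pi.single i (s * D.m i)))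

/-- The left-hand side of the quantum Serre relation. -/
def serre (D : AffineDatum I) (i j : I) (x y : FreeAlgebra K (UGen I)) :
    FreeAlgebra K (UGen I) :=
  ∑ k ∈ Finset.range ((1 - D.A i j).toNat + 1),
    (-1) ^ k * D.dpow i x k * y * D.dpow i x ((1 - D.A i j).toNat - k)

/-- The defining relations of `U'_q(g)`. -/
inductive URel (D : AffineDatum I) : FreeAlgebra K (UGen I) → FreeAlgebra K (UGen I) → Prop
  | q_zero : URel D (gen (.qh 0)) 1
  | q_add (n n' : I → ℤ) : URel D (gen (.qh n) * gen (.qh n')) (gen (.qh (n + n')))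
  | q_e (n : I → ℤ) (j : I) : URel D (gen (.qh n) * gen (.e j) * gen (.qh (-n)))
      (qs ^ (∑ i, n i * D.A i j) • gen (.e j))
  | q_f (n : I → ℤ) (j : I) : URel D (gen (.qh n) * gen (.f j) * gen (.qh (-n)))
      (qs ^ (-∑ i, n i * D.A i j) • gen (.f j))
  | ef_same (i : I) : URel D (gen (.e i) * gen (.f i) - gen (.f i) * gen (.e i))
      ((D.qi i - (D.qi i)⁻¹)⁻¹ • (tq D i 1 - tq D i (-1)))
  | ef_ne (i j : I) (h : i ≠ j) : URel D (gen (.e i) * gen (.f j) - gen (.f j) * gen (.e i)) 0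
  | serre_e (i j : I) (h : i ≠ j) : URel D (serre D i j (gen (.e i)) (gen (.e j))) 0
  | serre_f (i j : I) (h : i ≠ j) : URel D (serre D i j (gen (.f i)) (gen (.f j))) 0

/-- The quantized affine algebra `U'_q(g)` (without derivation). -/
abbrev Uq (D : AffineDatum I) : Type w := RingQuot (URel D)

/-- The images of the generators in `U'_q(g)`. -/
def Uq.gen (D : AffineDatum I) (x : UGen I) : Uq D :=
  RingQuot.mkAlgHom K (URel D) (FreeAlgebra.ι K x)

section Modules

variable {D : AffineDatum I} {V : Type} [AddCommGroup V] [Module K V]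
  (ρ : Uq D →ₐ[K] Module.End K V)

/-- The weight space `V_μ`. -/
def weightSpace (μ : Pcl I) : Submodule K V :=
  ⨅ n : I → ℤ, LinearMap.ker (ρ (Uq.gen D (.qh n)) - (qs ^ (∑ i, n i * μ i)) • LinearMap.id)

/-- The weight space decomposition.  (For finite-dimensional modules this is integrability;
weight spaces for distinct weights are automatically independent.) -/
def IsIntegrable : Prop := ⨆ μ : Pcl I, weightSpace ρ μ = ⊤

/-- `f_i^{(n)} u`. -/
def fdiv (i : I) (n : ℕ) (u : V) : V := D.dpow i (ρ (Uq.gen D (.f i))) n u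

/-- `E i` and `F i` are the Kashiwara operators `ẽ_i` and `f̃_i` of an integrable module:
`ẽ_i (f_i^{(n)} u) = f_i^{(n-1)} u` (understood as `0` for `n = 0`) and
`f̃_i (f_i^{(n)} u) = f_i^{(n+1)} u` for all `u ∈ ker e_i ∩ V_μ` and `0 ≤ n ≤ ⟨h i, μ⟩`.
The vectors `f_i^{(n)} u` span the module, so that these rules determine `E i` and `F i`. -/
structure IsKashiwara (E F : I → Module.End K V) : Prop where
  E_zero : ∀ i u, ρ (Uq.gen D (.e i)) u = 0 → E i u = 0
  E_succ : ∀ i μ, ∀ u ∈ weightSpace ρ μ, ρ (Uq.gen D (.e i)) u = 0 → ∀ n : ℕ,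
    (n : ℤ) + 1 ≤ μ i → E i (fdiv ρ i (n + 1) u) = fdiv ρ i n u
  F_div : ∀ i μ, ∀ u ∈ weightSpace ρ μ, ρ (Uq.gen D (.e i)) u = 0 → ∀ n : ℕ,
    (n : ℤ) ≤ μ i → F i (fdiv ρ i n u) = fdiv ρ i (n + 1) u

/-- The local ring of the rational functions in `q_s` that are regular at `q_s = 0`. -/
def A₀ : Subring K where
  carrier := {x | x.denom.eval 0 ≠ 0}
  one_mem' := by simp
  zero_mem' := by simp
  mul_mem' := by
    intro x y hx hy h
    obtain ⟨p, hp⟩ := RatFunc.denom_mul_dvd x y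
    have := congrArg (Polynomial.eval 0) hp
    rw [Polynomial.eval_mul, Polynomial.eval_mul, h, zero_mul] at this
    exact mul_ne_zero hx hy this
  add_mem' := by
    intro x y hx hy h
    obtain ⟨p, hp⟩ := RatFunc.denom_add_dvd x y
    have := congrArg (Polynomial.eval 0) hp
    rw [Polynomial.eval_mul, Polynomial.eval_mul, h, zero_mul] at this
    exact mul_ne_zero hx hy this
  neg_mem' := by
    intro x hx h
    obtain ⟨p, hp⟩ := RatFunc.denom_mul_dvd (-1) x
    have h1 : (-1 : RatFunc ℂ).denom = 1 := by
      have := RatFunc.denom_C (K := ℂ) (-1)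
      rwa [map_neg, map_one] at this
    have := congrArg (Polynomial.eval 0) hp
    rw [neg_one_mul, h1, one_mul, Polynomial.eval_mul, h, zero_mul] at this
    exact hx this

/-- A crystal lattice: a free `A₀`-submodule `L` that generates `V` over `K`, is the sum of its
weight components `L ∩ V_μ`, and is stable under the Kashiwara operators. -/
structure IsCrystalLattice (E F : I → Module.End K V) (L : Submodule A₀ V) : Prop where
  free : Module.Free A₀ L
  span : Submodule.span K (L : Set V) = ⊤
  weight : ∀ u ∈ L, u ∈ Submodule.span A₀ {x : V | x ∈ L ∧ ∃ μ, x ∈ weightSpace ρ μ}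
  E_mem : ∀ i, ∀ u ∈ L, E i u ∈ L
  F_mem : ∀ i, ∀ u ∈ L, F i u ∈ L

/-- `x ≡ y` modulo `q_s L`. -/
def CongrMod (L : Submodule A₀ V) (x y : V) : Prop := ∃ u ∈ L, x - y = qs • u

/-- The vectors `v b ∈ L` represent a pseudo-base `{± [v b]}` of `L / q_s L` whose quotient by
`±1`, with its weights and Kashiwara operators, is the crystal `C`:
`[v b]` (`b ∈ C`) is a `ℂ`-basis of `L / q_s L`; `[v b]` has weight `wt b`; the operators
`ẽ_i`, `f̃_i` on `L / q_s L` act on the classes `[v b]` up to sign by the operators of `C`;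
and, for `x`, `y` in the pseudo-base, `f̃_i x = y` if and only if `x = ẽ_i y`. -/
structure IsPseudoBase (C : Crystal.{u} D) (E F : I → Module.End K V) (L : Submodule A₀ V)
    (v : C.carrier → V) : Prop where
  mem : ∀ b, v b ∈ L
  weight : ∀ b, v b ∈ weightSpace ρ (C.wt b)
  basis : ∀ x ∈ L, ∃! z : C.carrier →₀ ℂ,
    CongrMod L x (z.sum fun b r => (RatFunc.C r : K) • v b)
  E_none : ∀ i b, C.e i b = none → CongrMod L (E i (v b)) 0
  F_none : ∀ i b, C.f i b = none → CongrMod L (F i (v b)) 0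
  F_some : ∀ i b b', C.f i b = some b' →
    ∃ s : ℤˣ, CongrMod L (F i (v b)) ((s : ℤ) • v b') ∧ CongrMod L (E i (v b')) ((s : ℤ) • v b)

end Modules

/-! ### Perfect crystals, coherent families -/

namespace Crystal

variable {D : AffineDatum I}

/-- `C` is isomorphic to the crystal `B_ps / ±1` of a crystal pseudo-base `(L, B_ps)` of some
finite-dimensional integrable `U'_q(g)`-module. -/
def ComesFromModule (C : Crystal.{u} D) : Prop :=
  C.StringLengths ∧
  ∃ (V : Type) (_ : AddCommGroup V) (_ : Module K V) (_ : FiniteDimensional K V)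
    (ρ : Uq D →ₐ[K] Module.End K V) (E F : I → Module.End K V) (L : Submodule A₀ V)
    (v : C.carrier → V),
    IsIntegrable ρ ∧ IsKashiwara ρ E F ∧ IsCrystalLattice ρ E F L ∧ IsPseudoBase ρ C E F L v

/-- Perfect crystals of level `l`. -/
structure IsPerfect (C : Crystal.{u} D) (l : ℕ) : Prop where
  connected : (C.tensor C).Connected
  extremal : ∃ μ₀ : Pcl I,
    (∀ b, ∃ n : I → ℕ, n D.zero = 0 ∧ C.wt b = μ₀ - ∑ i, (n i : ℤ) • D.root i) ∧
    ∃! b, C.wt b = μ₀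
  ofModule : C.ComesFromModule
  le_level : ∀ b, (l : ℤ) ≤ D.level (C.eps b)
  bij_eps : Set.BijOn C.eps (C.minSet l) (D.dominant l)
  bij_phi : Set.BijOn C.phi (C.minSet l) (D.dominant l)

/-- `(Binf, binf)` is a limit of the family `B l` (`l ≥ 1`). -/
def IsLimit (B : ℕ → Crystal.{u} D) (Binf : Crystal.{u} D) (binf : Binf.carrier) : Prop :=
  Binf.wt binf = 0 ∧ (∀ i, Binf.ε i binf = 0) ∧ (∀ i, Binf.φ i binf = 0) ∧
  ∃ F : ∀ (l : ℕ) (b : (B l).carrier),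
      Option ((B l).shift ((B l).eps b) (-(B l).phi b)).carrier → Option Binf.carrier,
    (∀ l, 1 ≤ l → ∀ b ∈ (B l).minSet l,
      IsEmbedding ((B l).shift ((B l).eps b) (-(B l).phi b)) Binf (F l b) ∧
      F l b (some ((B l).shiftElt _ _ b)) = some binf) ∧
    ∀ x : Binf.carrier, ∃ l, 1 ≤ l ∧ ∃ b ∈ (B l).minSet l, ∃ y, F l b (some y) = some x

/-- `B l` (`l ≥ 1`) is a coherent family of perfect crystals. -/
def IsCoherent (B : ℕ → Crystal.{u} D) : Prop :=
  (∀ l, 1 ≤ l → (B l).IsPerfect l) ∧ ∃ Binf binf, IsLimit B Binf binf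

/-- The linear automorphism `σ` of `P_cl` extends the automorphism of `P_cl^0` determined by
`φ(b) ↦ ε(b)` (`b ∈ B_∞^min`), and `σ φ(b) = ε(b)` for all `l ≥ 1` and `b ∈ B_l^min`. -/
def IsSigma (B : ℕ → Crystal.{u} D) (σ : Pcl I ≃ₗ[ℤ] Pcl I) : Prop :=
  (∀ Binf binf, IsLimit B Binf binf → ∀ b ∈ Binf.minSet 0, σ (Binf.phi b) = Binf.eps b) ∧
  ∀ l, 1 ≤ l → ∀ b ∈ (B l).minSet l, σ ((B l).phi b) = (B l).eps b

end Crystal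

end AffineCrystals

end

/-!
All crystals `T_{ε(b)} ⊗ B_l ⊗ T_{-φ(b)}` (`b ∈ B_l^min`) live inside `B_∞` and contain `b_∞`.
Take `b₁ ∈ B_{l-k}^min` and let `b₂ ∈ B_l^min` be the element with `ε(b₂) = ε(b₁) + μ`; then
`φ(b₂) = φ(b₁) + σ⁻¹ μ`, because `σ φ = ε` on minimal elements.  The weight `σ⁻¹ μ` is itself
dominant, being `φ(b)` for the element `b ∈ B_k^min` with `ε(b) = μ`.

In a crystal of a finite-dimensional module, `ẽ_i x ≠ 0` exactly when `ε_i(x) > 0`, and the twist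
by `T_{ε(b)} ⊗ - ⊗ T_{-φ(b)}` lowers `ε_i` by `ε_i(b)` and `φ_i` by `φ_i(b)`.  So at a common point
of the two images in `B_∞`, every arrow present in the image of `B_{l-k}` is also present in the
image of `B_l`, the latter having been lowered by more.  As `B_{l-k}` is connected and the two
images share `b_∞`, the first image is contained in the second
(`Crystal.IsEmbedding.exists_factor`), and removing the common twist gives the
embedding (`Crystal.IsEmbedding.exists_unshift`).

An embedding preserves `ε`, hence sends a minimal element `b` to the unique minimal element with
`ε`-value `ε(b) + μ`; since `B_{l-k}` is connected, an embedding is determined by its value at one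
element (`Crystal.IsEmbedding.eq_of_connected`), which gives uniqueness.
-/

namespace AffineCrystals

namespace AffineDatum

variable {I : Type*} [Fintype I] (D : AffineDatum I)

theorem level_add (μ ν : Pcl I) : D.level (μ + ν) = D.level μ + D.level ν := by
  simp [level, mul_add, Finset.sum_add_distrib]

theorem dominant_nonempty (l : ℕ) : (D.dominant l).Nonempty := by
  classical
  -- The weight `l Λ₀` has level `l` because `c_0 = 1`.
  refine ⟨Pi.single D.zero (l : ℤ), fun i => ?_, ?_⟩
  · by_cases h : i = D.zero
    · subst h; simp
    · simp [h]
  · simp [level, Pi.single_apply, D.c_zero]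

theorem add_mem_dominant {k l : ℕ} {μ ν : Pcl I} (hμ : μ ∈ D.dominant k)
    (hν : ν ∈ D.dominant l) : μ + ν ∈ D.dominant (k + l) :=
  ⟨fun i => add_nonneg (hμ.1 i) (hν.1 i), by rw [level_add, hμ.2, hν.2]; push_cast; rfl⟩

end AffineDatum

namespace Crystal

universe u

variable {I : Type*} [Fintype I] {D : AffineDatum I}

/-! ### The twisted crystals `T_μ ⊗ C ⊗ T_ν` -/

section Shift

variable (C : Crystal.{u} D) (μ ν : Pcl I)

theorem shift_wt (b : C.carrier) :
    (C.shift μ ν).wt (C.shiftElt μ ν b) = μ + C.wt b + ν := rfl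

theorem shift_eps (i : I) (b : C.carrier) :
    (C.shift μ ν).ε i (C.shiftElt μ ν b) = C.ε i b + ((-μ i : ℤ) : WithBot ℤ) := by
  simp [shift, shiftElt, tensor, T]

theorem shift_phi (i : I) (b : C.carrier) :
    (C.shift μ ν).φ i (C.shiftElt μ ν b) = C.φ i b + ((ν i : ℤ) : WithBot ℤ) := by
  simp [shift, shiftElt, tensor, T]

theorem phi_eq_bot_iff (i : I) (b : C.carrier) : C.φ i b = ⊥ ↔ C.ε i b = ⊥ := by
  rw [C.phi_eq]
  cases C.ε i b with
  | bot => simp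
  | coe x => simp [← WithBot.coe_add]

theorem shift_e (i : I) (b : C.carrier) :
    (C.shift μ ν).e i (C.shiftElt μ ν b) = (C.e i b).map (C.shiftElt μ ν) := by
  by_cases h : C.ε i b = ⊥
  · simp [shift, shiftElt, tensor, T, tensorE, h, (C.of_eps_bot i b h).1]; rfl
  · simp [shift, tensor, T, tensorE, h, shiftElt, Function.comp_def]; rfl

theorem shift_f (i : I) (b : C.carrier) :
    (C.shift μ ν).f i (C.shiftElt μ ν b) = (C.f i b).map (C.shiftElt μ ν) := by
  by_cases h : C.ε i b = ⊥
  · simp [shift, shiftElt, tensor, T, tensorF, (C.phi_eq_bot_iff i b).2 h,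
      (C.of_eps_bot i b h).2]; rfl
  · have h' : ⊥ < C.φ i b := bot_lt_iff_ne_bot.2 (mt (C.phi_eq_bot_iff i b).1 h)
    simp [shift, tensor, T, tensorF, h', shiftElt, Function.comp_def]; rfl

theorem shiftElt_bijective : Function.Bijective (C.shiftElt μ ν) :=
  ⟨fun _ _ h => congrArg (fun x => x.1.2) h, fun x => ⟨x.1.2, rfl⟩⟩

end Shift

/-! ### Connectedness and string lengths -/

/-- An arrow of `C ⊗ C` is an arrow or an equality in the first factor, so a path in `C ⊗ C`
projects to a path in `C`. -/
theorem Connected.of_tensor {C₁ C₂ : Crystal.{u} D} (h : (C₁.tensor C₂).Connected) :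
    C₁.Connected := by
  obtain ⟨⟨b₀⟩, h⟩ := h
  refine ⟨⟨b₀.1⟩, fun b b' => ?_⟩
  have key : ∀ x y : (C₁.tensor C₂).carrier,
      Relation.EqvGen (fun x y => ∃ i, (C₁.tensor C₂).f i x = some y) x y →
      Relation.EqvGen (fun x y : C₁.carrier => ∃ i, C₁.f i x = some y) x.1 y.1 := by
    intro x y hxy
    induction hxy with
    | rel x y hxy =>
      obtain ⟨i, hi⟩ := hxy
      change tensorF C₁ C₂ i x = some y at hi
      unfold tensorF at hi
      split_ifs at hi
      · obtain ⟨z, hz, rfl⟩ := Option.map_eq_some_iff.1 hi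
        exact .rel _ _ ⟨i, hz⟩
      · obtain ⟨z, hz, rfl⟩ := Option.map_eq_some_iff.1 hi
        exact .refl _
    | refl x => exact .refl _
    | symm x y _ ih => exact .symm _ _ ih
    | trans x y z _ _ ih₁ ih₂ => exact .trans _ _ _ ih₁ ih₂
  exact key (b, b₀.2) (b', b₀.2) (h _ _)

/-- In a connected crystal, a property stable under all `ẽ_i` and `f̃_i` that holds at one element
holds everywhere. -/
theorem Connected.induction {C : Crystal.{u} D} (h : C.Connected) {p : C.carrier → Prop}
    (hf : ∀ i x y, C.f i x = some y → p x → p y) (he : ∀ i x y, C.e i x = some y → p x → p y)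
    {a : C.carrier} (ha : p a) (b : C.carrier) : p b := by
  have key : ∀ x y, Relation.EqvGen (fun x y : C.carrier => ∃ i, C.f i x = some y) x y →
      (p x ↔ p y) := by
    intro x y hxy
    induction hxy with
    | rel x y hxy =>
      obtain ⟨i, hi⟩ := hxy
      exact ⟨hf i x y hi, he i y x ((C.f_iff_e i x y).1 hi)⟩
    | refl x => exact Iff.rfl
    | symm x y _ ih => exact ih.symm
    | trans x y z _ _ ih₁ ih₂ => exact ih₁.trans ih₂
  exact (key a b (h.2 a b)).1 ha

theorem Connected.shift {C : Crystal.{u} D} (h : C.Connected) (μ ν : Pcl I) :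
    (C.shift μ ν).Connected := by
  obtain ⟨⟨b₀⟩, h⟩ := h
  refine ⟨⟨C.shiftElt μ ν b₀⟩, fun x y => ?_⟩
  have key : ∀ b b', Relation.EqvGen (fun x y : C.carrier => ∃ i, C.f i x = some y) b b' →
      Relation.EqvGen (fun x y : (C.shift μ ν).carrier => ∃ i, (C.shift μ ν).f i x = some y)
        (C.shiftElt μ ν b) (C.shiftElt μ ν b') := by
    intro b b' hb
    induction hb with
    | rel b b' hb =>
      obtain ⟨i, hi⟩ := hb
      exact .rel _ _ ⟨i, by rw [shift_f, hi]; rfl⟩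
    | refl x => exact .refl _
    | symm x y _ ih => exact .symm _ _ ih
    | trans x y z _ _ ih₁ ih₂ => exact .trans _ _ _ ih₁ ih₂
  exact key x.1.2 y.1.2 (h _ _)

/-- The greatest `n` with `g^n b ≠ 0` is positive exactly when `g b ≠ 0`. -/
theorem ne_none_iff_pos_of_isGreatest {α : Type*} {g : α → Option α} {b : α} {n : ℕ}
    (h : IsGreatest {m : ℕ | (fun x => x.bind g)^[m] (some b) ≠ none} n) :
    g b ≠ none ↔ 0 < n := by
  refine ⟨fun hb => h.2 (show 1 ∈ _ by simpa using hb), fun hn hb => h.1 ?_⟩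
  obtain ⟨m, rfl⟩ := Nat.exists_eq_succ_of_ne_zero hn.ne'
  rw [Function.iterate_succ_apply, Option.bind_some, hb]
  exact Function.iterate_fixed rfl m

theorem StringLengths.coe_eps {C : Crystal.{u} D} (h : C.StringLengths) (i : I)
    (b : C.carrier) : C.ε i b = ((C.eps b i : ℤ) : WithBot ℤ) := by
  obtain ⟨n, hn, -⟩ := (h i b).1
  simp [eps, hn]

theorem StringLengths.coe_phi {C : Crystal.{u} D} (h : C.StringLengths) (i : I)
    (b : C.carrier) : C.φ i b = ((C.phi b i : ℤ) : WithBot ℤ) := by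
  obtain ⟨n, hn, -⟩ := (h i b).2
  simp [phi, hn]

theorem StringLengths.e_ne_none_iff {C : Crystal.{u} D} (h : C.StringLengths) (i : I)
    (b : C.carrier) : C.e i b ≠ none ↔ 0 < C.eps b i := by
  obtain ⟨n, hn, hg⟩ := (h i b).1
  rw [ne_none_iff_pos_of_isGreatest hg]
  simp [eps, hn]

theorem StringLengths.f_ne_none_iff {C : Crystal.{u} D} (h : C.StringLengths) (i : I)
    (b : C.carrier) : C.f i b ≠ none ↔ 0 < C.phi b i := by
  obtain ⟨n, hn, hg⟩ := (h i b).2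
  rw [ne_none_iff_pos_of_isGreatest hg]
  simp [phi, hn]

/-! ### Embeddings -/

namespace IsEmbedding

variable {C₁ C₂ C₃ : Crystal.{u} D}

theorem exists_some {ψ : Option C₁.carrier → Option C₂.carrier} (h : IsEmbedding C₁ C₂ ψ)
    (b : C₁.carrier) : ∃ x, ψ (some b) = some x := by
  refine Option.ne_none_iff_exists'.1 fun hb => ?_
  simpa using h.2 (hb.trans h.1.map_zero.symm)

theorem map_e {ψ : Option C₁.carrier → Option C₂.carrier} (h : IsEmbedding C₁ C₂ ψ) {i : I}
    {b b' : C₁.carrier} {x : C₂.carrier} (hb : C₁.e i b = some b') (hx : ψ (some b) = some x) :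
    C₂.e i x = ψ (some b') := by
  obtain ⟨x', hx'⟩ := h.exists_some b'
  rw [hx', h.1.map_e i b b' x x' hb hx hx']

theorem map_f {ψ : Option C₁.carrier → Option C₂.carrier} (h : IsEmbedding C₁ C₂ ψ) {i : I}
    {b b' : C₁.carrier} {x : C₂.carrier} (hb : C₁.f i b = some b') (hx : ψ (some b) = some x) :
    C₂.f i x = ψ (some b') := by
  obtain ⟨x', hx'⟩ := h.exists_some b'
  rw [hx', h.1.map_f i b b' x x' hb hx hx']

theorem eq_of_connected {ψ ψ' : Option C₁.carrier → Option C₂.carrier}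
    (h : IsEmbedding C₁ C₂ ψ) (h' : IsEmbedding C₁ C₂ ψ') (hC : C₁.Connected)
    {a : C₁.carrier} (ha : ψ (some a) = ψ' (some a)) : ψ = ψ' := by
  have key : ∀ b, ψ (some b) = ψ' (some b) := by
    refine hC.induction (fun i x y hxy hx => ?_) (fun i x y hxy hx => ?_) ha
    · obtain ⟨z, hz⟩ := h.exists_some x
      rw [← h.map_f hxy hz, ← h'.map_f hxy (hx ▸ hz)]
    · obtain ⟨z, hz⟩ := h.exists_some x
      rw [← h.map_e hxy hz, ← h'.map_e hxy (hx ▸ hz)]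
  funext b
  cases b with
  | none => rw [h.1.map_zero, h'.1.map_zero]
  | some b => exact key b

/-- Two crystals embedded in a third one, the first of them connected, with images that have a
point in common: if at common points every arrow of the first is also an arrow of the second,
then the first embedding factors through the second. -/
theorem exists_factor {G₁ : Option C₁.carrier → Option C₃.carrier}
    {G₂ : Option C₂.carrier → Option C₃.carrier} (h₁ : IsEmbedding C₁ C₃ G₁)
    (h₂ : IsEmbedding C₂ C₃ G₂) (hC : C₁.Connected)
    {a : C₁.carrier} {a' : C₂.carrier} (ha : G₁ (some a) = G₂ (some a'))
    (he : ∀ i x y, G₁ (some x) = G₂ (some y) → C₁.e i x ≠ none → C₂.e i y ≠ none)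
    (hf : ∀ i x y, G₁ (some x) = G₂ (some y) → C₁.f i x ≠ none → C₂.f i y ≠ none) :
    ∃ ψ, IsEmbedding C₁ C₂ ψ := by
  have stepE : ∀ i x x' y, C₁.e i x = some x' → G₁ (some x) = G₂ (some y) →
      ∃ y', C₂.e i y = some y' ∧ G₁ (some x') = G₂ (some y') := by
    intro i x x' y hx hxy
    obtain ⟨y', hy'⟩ := Option.ne_none_iff_exists'.1 (he i x y hxy (by simp [hx]))
    obtain ⟨z, hz⟩ := h₁.exists_some x
    exact ⟨y', hy', by rw [← h₁.map_e hx hz, ← h₂.map_e hy' (hxy ▸ hz)]⟩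
  have stepF : ∀ i x x' y, C₁.f i x = some x' → G₁ (some x) = G₂ (some y) →
      ∃ y', C₂.f i y = some y' ∧ G₁ (some x') = G₂ (some y') := by
    intro i x x' y hx hxy
    obtain ⟨y', hy'⟩ := Option.ne_none_iff_exists'.1 (hf i x y hxy (by simp [hx]))
    obtain ⟨z, hz⟩ := h₁.exists_some x
    exact ⟨y', hy', by rw [← h₁.map_f hx hz, ← h₂.map_f hy' (hxy ▸ hz)]⟩
  have total : ∀ x, ∃ y, G₁ (some x) = G₂ (some y) := by
    refine hC.induction (fun i x x' hx h => ?_) (fun i x x' hx h => ?_) ⟨a', ha⟩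
    · obtain ⟨y, hy⟩ := h
      obtain ⟨y', -, hy'⟩ := stepF i x x' y hx hy
      exact ⟨y', hy'⟩
    · obtain ⟨y, hy⟩ := h
      obtain ⟨y', -, hy'⟩ := stepE i x x' y hx hy
      exact ⟨y', hy'⟩
  choose g hg using total
  have uniq : ∀ x y, G₁ (some x) = G₂ (some y) → g x = y := fun x y h =>
    Option.some_injective _ (h₂.2 ((hg x).symm.trans h))
  have inj : Function.Injective g := fun x x' h =>
    Option.some_injective _ (h₁.2 (by rw [hg x, hg x', h]))
  refine ⟨Option.map g, ⟨rfl, ?_, ?_, ?_, ?_, ?_⟩, Option.map_injective inj⟩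
  · rintro i b b' _ _ hb ⟨⟩ ⟨⟩
    obtain ⟨y, hy, hy'⟩ := stepE i b b' (g b) hb (hg b)
    rw [hy, uniq _ _ hy']
  · rintro i b b' _ _ hb ⟨⟩ ⟨⟩
    obtain ⟨y, hy, hy'⟩ := stepF i b b' (g b) hb (hg b)
    rw [hy, uniq _ _ hy']
  · rintro b _ ⟨⟩
    obtain ⟨z, hz⟩ := h₁.exists_some b
    rw [← h₁.1.map_wt b z hz, ← h₂.1.map_wt (g b) z (hg b ▸ hz)]
  · rintro i b _ ⟨⟩
    obtain ⟨z, hz⟩ := h₁.exists_some b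
    rw [← h₁.1.map_eps i b z hz, ← h₂.1.map_eps i (g b) z (hg b ▸ hz)]
  · rintro i b _ ⟨⟩
    obtain ⟨z, hz⟩ := h₁.exists_some b
    rw [← h₁.1.map_phi i b z hz, ← h₂.1.map_phi i (g b) z (hg b ▸ hz)]

/-- A common twist can be removed from an embedding of twisted crystals. -/
theorem exists_unshift {μ ν κ τ : Pcl I}
    {ψ : Option (C₁.shift μ ν).carrier → Option (C₂.shift (μ + κ) (ν + τ)).carrier}
    (h : IsEmbedding (C₁.shift μ ν) (C₂.shift (μ + κ) (ν + τ)) ψ) :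
    ∃ ψ', IsEmbedding C₁ (C₂.shift κ τ) ψ' := by
  have total : ∀ b, ∃ y : C₂.carrier,
      ψ (some (C₁.shiftElt μ ν b)) = some (C₂.shiftElt (μ + κ) (ν + τ) y) := fun b => by
    obtain ⟨x, hx⟩ := h.exists_some (C₁.shiftElt μ ν b)
    exact ⟨x.1.2, hx⟩
  choose g hg using total
  have inj : Function.Injective g := fun x x' hx =>
    (C₁.shiftElt_bijective μ ν).1 (Option.some_injective _ (h.2 (by rw [hg x, hg x', hx])))
  have cancel : ∀ (a b : WithBot ℤ) (m n : ℤ),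
      a + ((m + n : ℤ) : WithBot ℤ) = b + ((m : ℤ) : WithBot ℤ) →
      a + ((n : ℤ) : WithBot ℤ) = b := by
    intro a b m n
    cases a <;> cases b <;> simp only [WithBot.bot_add, ← WithBot.coe_add, WithBot.coe_inj,
      WithBot.bot_ne_coe, WithBot.coe_ne_bot, imp_self]
    grind
  refine ⟨Option.map (C₂.shiftElt κ τ ∘ g), ⟨rfl, ?_, ?_, ?_, ?_, ?_⟩,
    Option.map_injective ((C₂.shiftElt_bijective κ τ).1.comp inj)⟩
  · rintro i b b' _ _ hb ⟨⟩ ⟨⟩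
    have := h.1.map_e i _ _ _ _ (by rw [shift_e, hb]; rfl) (hg b) (hg b')
    rw [shift_e] at this
    obtain ⟨y, hy, hy'⟩ := Option.map_eq_some_iff.1 this
    rw [Function.comp_apply, shift_e, hy, (C₂.shiftElt_bijective _ _).1 hy']
    rfl
  · rintro i b b' _ _ hb ⟨⟩ ⟨⟩
    have := h.1.map_f i _ _ _ _ (by rw [shift_f, hb]; rfl) (hg b) (hg b')
    rw [shift_f] at this
    obtain ⟨y, hy, hy'⟩ := Option.map_eq_some_iff.1 this
    rw [Function.comp_apply, shift_f, hy, (C₂.shiftElt_bijective _ _).1 hy']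
    rfl
  · rintro b _ ⟨⟩
    have := h.1.map_wt _ _ (hg b)
    rw [shift_wt, shift_wt] at this
    rw [Function.comp_apply, shift_wt]
    ext i
    have := congrFun this i
    simp only [Pi.add_apply] at this ⊢
    linarith
  · rintro i b _ ⟨⟩
    have := h.1.map_eps i _ _ (hg b)
    rw [shift_eps, shift_eps, Pi.add_apply, neg_add] at this
    rw [Function.comp_apply, shift_eps]
    exact cancel _ _ _ _ this
  · rintro i b _ ⟨⟩
    have := h.1.map_phi i _ _ (hg b)
    rw [shift_phi, shift_phi, Pi.add_apply] at this
    rw [Function.comp_apply, shift_phi]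
    exact cancel _ _ _ _ this

/-- Two twisted crystals inside `C₃` with a common point: if the second is twisted by more on
both sides, then the first crystal embeds in the second one with the difference of the twists. -/
theorem exists_of_shift {μ ν κ τ : Pcl I} (hs₁ : C₁.StringLengths) (hs₂ : C₂.StringLengths)
    (hC : C₁.Connected) (hκ : ∀ i, 0 ≤ κ i) (hτ : ∀ i, τ i ≤ 0)
    {G₁ : Option (C₁.shift μ ν).carrier → Option C₃.carrier}
    {G₂ : Option (C₂.shift (μ + κ) (ν + τ)).carrier → Option C₃.carrier}
    (h₁ : IsEmbedding (C₁.shift μ ν) C₃ G₁)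
    (h₂ : IsEmbedding (C₂.shift (μ + κ) (ν + τ)) C₃ G₂)
    {a : C₁.carrier} {a' : C₂.carrier}
    (ha : G₁ (some (C₁.shiftElt _ _ a)) = G₂ (some (C₂.shiftElt _ _ a'))) :
    ∃ ψ, IsEmbedding C₁ (C₂.shift κ τ) ψ := by
  suffices h : ∃ ψ, IsEmbedding (C₁.shift μ ν) (C₂.shift (μ + κ) (ν + τ)) ψ by
    obtain ⟨ψ, hψ⟩ := h
    exact hψ.exists_unshift
  refine h₁.exists_factor h₂ (hC.shift μ ν) ha ?_ ?_
  · intro i x y hxy hx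
    obtain ⟨b, rfl⟩ := (C₁.shiftElt_bijective _ _).2 x
    obtain ⟨b', rfl⟩ := (C₂.shiftElt_bijective _ _).2 y
    rw [shift_e, Ne, Option.map_eq_none_iff, ← Ne, hs₁.e_ne_none_iff] at hx
    rw [shift_e, Ne, Option.map_eq_none_iff, ← Ne, hs₂.e_ne_none_iff]
    obtain ⟨z, hz⟩ := h₁.exists_some (C₁.shiftElt μ ν b)
    have := (h₁.1.map_eps i _ z hz).symm.trans (h₂.1.map_eps i _ z (hxy ▸ hz))
    rw [shift_eps, shift_eps, hs₁.coe_eps, hs₂.coe_eps, ← WithBot.coe_add, ← WithBot.coe_add,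
      WithBot.coe_inj, Pi.add_apply] at this
    linarith [hκ i]
  · intro i x y hxy hx
    obtain ⟨b, rfl⟩ := (C₁.shiftElt_bijective _ _).2 x
    obtain ⟨b', rfl⟩ := (C₂.shiftElt_bijective _ _).2 y
    rw [shift_f, Ne, Option.map_eq_none_iff, ← Ne, hs₁.f_ne_none_iff] at hx
    rw [shift_f, Ne, Option.map_eq_none_iff, ← Ne, hs₂.f_ne_none_iff]
    obtain ⟨z, hz⟩ := h₁.exists_some (C₁.shiftElt μ ν b)
    have := (h₁.1.map_phi i _ z hz).symm.trans (h₂.1.map_phi i _ z (hxy ▸ hz))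
    rw [shift_phi, shift_phi, hs₁.coe_phi, hs₂.coe_phi, ← WithBot.coe_add, ← WithBot.coe_add,
      WithBot.coe_inj, Pi.add_apply] at this
    linarith [hτ i]

/-- An embedding in `T_κ ⊗ C₂ ⊗ T_τ` adds `κ` to the `ε`-values in `C₁` and `C₂`. -/
theorem exists_eps_eq_add {κ τ : Pcl I} (hs₁ : C₁.StringLengths) (hs₂ : C₂.StringLengths)
    {ψ : Option C₁.carrier → Option (C₂.shift κ τ).carrier}
    (h : IsEmbedding C₁ (C₂.shift κ τ) ψ) (b : C₁.carrier) :
    ∃ b', ψ (some b) = some (C₂.shiftElt κ τ b') ∧ C₂.eps b' = C₁.eps b + κ := by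
  obtain ⟨x, hx⟩ := h.exists_some b
  obtain ⟨b', rfl⟩ := (C₂.shiftElt_bijective _ _).2 x
  refine ⟨b', hx, funext fun i => ?_⟩
  have := h.1.map_eps i _ _ hx
  rw [shift_eps, hs₁.coe_eps, hs₂.coe_eps, ← WithBot.coe_add, WithBot.coe_inj] at this
  rw [Pi.add_apply]
  linarith

end IsEmbedding

end Crystal

end AffineCrystals

/-! ### The embedding of `B_{l-k}` -/

open AffineCrystals Crystal in
theorem mainTheorem7 {I : Type*} [Fintype I] (D : AffineCrystals.AffineDatum I)
    (B : ℕ → AffineCrystals.Crystal D) (hB : AffineCrystals.Crystal.IsCoherent B)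
    (σ : AffineCrystals.Pcl I ≃ₗ[ℤ] AffineCrystals.Pcl I)
    (hσ : AffineCrystals.Crystal.IsSigma B σ)
    (k l : ℕ) (hk : 1 ≤ k) (hkl : k < l)
    (μ : AffineCrystals.Pcl I) (hμ : μ ∈ D.dominant k) :
    (∃! ψ : Option (B (l - k)).carrier → Option ((B l).shift μ (-(σ.symm μ))).carrier,
      AffineCrystals.Crystal.IsEmbedding (B (l - k)) ((B l).shift μ (-(σ.symm μ))) ψ) ∧
    ∀ ψ : Option (B (l - k)).carrier → Option ((B l).shift μ (-(σ.symm μ))).carrier,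
      AffineCrystals.Crystal.IsEmbedding (B (l - k)) ((B l).shift μ (-(σ.symm μ))) ψ →
      ∀ b ∈ (B (l - k)).minSet (l - k), ∃ b' ∈ (B l).minSet l,
        ψ (some b) = some ((B l).shiftElt μ (-(σ.symm μ)) b') := by
  obtain ⟨hP, Binf, binf, -, -, -, F, hF, -⟩ := hB
  have hm : 1 ≤ l - k := by omega
  have hl : 1 ≤ l := by omega
  have hs₁ := (hP _ hm).ofModule.1
  have hs₂ := (hP _ hl).ofModule.1
  have hconn := (hP _ hm).connected.of_tensor
  obtain ⟨ν, hν⟩ := D.dominant_nonempty (l - k)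
  obtain ⟨b₁, hb₁, rfl⟩ := (hP _ hm).bij_eps.surjOn hν
  have hadd : (B (l - k)).eps b₁ + μ ∈ D.dominant l := by
    simpa [Nat.sub_add_cancel hkl.le] using D.add_mem_dominant hν hμ
  obtain ⟨b₂, hb₂, hε⟩ := (hP _ hl).bij_eps.surjOn hadd
  have hφ : -(B l).phi b₂ = -(B (l - k)).phi b₁ + -(σ.symm μ) := by
    rw [← neg_add, neg_inj]
    apply σ.injective
    rw [map_add, hσ.2 l hl b₂ hb₂, hσ.2 _ hm b₁ hb₁, hε, LinearEquiv.apply_symm_apply]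
  have hτ : ∀ i, (-(σ.symm μ)) i ≤ 0 := by
    obtain ⟨b, hb, rfl⟩ := (hP k hk).bij_eps.surjOn hμ
    rw [← hσ.2 k hk b hb, LinearEquiv.symm_apply_apply]
    exact fun i => neg_nonpos.2 (((hP k hk).bij_phi.mapsTo hb).1 i)
  have hmin : ∀ ψ : Option (B (l - k)).carrier → Option ((B l).shift μ (-(σ.symm μ))).carrier,
      IsEmbedding (B (l - k)) ((B l).shift μ (-(σ.symm μ))) ψ →
      ∀ b ∈ (B (l - k)).minSet (l - k), ∃ b' ∈ (B l).minSet l,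
        ψ (some b) = some ((B l).shiftElt μ (-(σ.symm μ)) b') ∧
          (B l).eps b' = (B (l - k)).eps b + μ := by
    intro ψ hψ b hb
    obtain ⟨b', hb', he⟩ := hψ.exists_eps_eq_add hs₁ hs₂ b
    refine ⟨b', ?_, hb', he⟩
    have hb : D.level ((B (l - k)).eps b) = ((l - k : ℕ) : ℤ) := hb
    change D.level ((B l).eps b') = l
    rw [he, D.level_add, hb, hμ.2, ← Nat.cast_add, Nat.sub_add_cancel hkl.le]
  have hex : ∃ ψ, IsEmbedding (B (l - k)) ((B l).shift μ (-(σ.symm μ))) ψ := by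
    obtain ⟨h₁, h₁'⟩ := hF _ hm b₁ hb₁
    -- Quantifying over the embedding lets the twist in its type be rewritten.
    have hG : ∃ G, IsEmbedding ((B l).shift ((B l).eps b₂) (-(B l).phi b₂)) Binf G ∧
        G (some ((B l).shiftElt _ _ b₂)) = some binf := ⟨F l b₂, hF l hl b₂ hb₂⟩
    rw [hε, hφ] at hG
    obtain ⟨G, h₂, h₂'⟩ := hG
    exact h₁.exists_of_shift hs₁ hs₂ hconn hμ.1 hτ h₂ (h₁'.trans h₂'.symm)
  refine ⟨?_, fun ψ hψ b hb => ?_⟩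
  · obtain ⟨ψ, hψ⟩ := hex
    refine ⟨ψ, hψ, fun ψ' hψ' => hψ'.eq_of_connected hψ hconn (a := b₁) ?_⟩
    obtain ⟨b, hb, hψb, he⟩ := hmin ψ hψ b₁ hb₁
    obtain ⟨b', hb', hψb', he'⟩ := hmin ψ' hψ' b₁ hb₁
    rw [hψb, hψb', (hP _ hl).bij_eps.injOn hb' hb (he'.trans he.symm)]
  · obtain ⟨b', hb', h, -⟩ := hmin ψ hψ b hb
    exact ⟨b', hb', h⟩
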